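/- Let $K,L\ge 0$ be integers, let $M>0$ be real, and let $D,D'$ be probability distributions on $\mathbb R$. For $n\in\mathbb N$ and $\vec x\in[0,1]^K$, consider a market with $n$ students and $Mn$ universities of capacity $L$ (numbers that are not integers are rounded: $\lceil Mn\rceil$ universities, $\lfloor x_jn\rfloor$ proposals). Suppose that $x_j n$ proposals of type $j$ are made for each $j\in\{1,\dots,K\}$, each of them independently to a uniformly random university. For each proposal the university that receives it observes an independent signal, drawn from $D$ for a proposal of type $1$ and from $D'$ for a proposal of type $>1$, and each university accepts the $L$ proposals with the highest signals among those it received (all of them if it received at most $L$), ties between equal signals being broken uniformly at random. Let $f_{i}^{(n)}(\vec x)\cdot n$ be the expected number of accepted proposals of type $i$, for $1\le i\le K$, and put $f^{(n)}_0=0$. A vector $\vec y\in[0,1]^K$ (possibly depending on $n$), with the convention $y_0=1$, *solves the system* if $$y_i \;=\; y_{i-1}-f^{(n)}_{i-1}(\vec y)\pm o(1)\qquad\text{for all } i\in\{1,\dots,K\},\quad n\to\infty .$$ Then the system has a unique solution in $[0,1]^K$: there is exactly one vector $\vec y\in[0,1]^K$, independent of $n$, that solves it. Moreover the solution is unique up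 to $o(1)$ among vectors that depend on $n$: if $\vec z^{(n)}\in[0,1]^K$ is any sequence that solves the system, then $\vec z^{(n)}\to\vec y$ as $n\to\infty$. -/

import Mathlib

open MeasureTheory ProbabilityTheory Filter Asymptotics

noncomputable section

namespace ApplicationMarket

/-- Type `i` proposals (with `0`-based index `i : Fin K`), `N i` of them for each `i`. -/
abbrev Proposal {K : ℕ} (N : Fin K → ℕ) : Type := Σ i : Fin K, Fin (N i)

/-- Everything random about one proposal: the university it is sent to (among `m`), the signal that
the university observes, and a tie-breaking mark that matters only when two signals coincide. -/
abbrev Draw (m : ℕ) : Type := Fin m × ℝ × ℝ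

/-- The law of all proposals. They are independent; each goes to a uniformly random university, its
signal has law `D` if it is a student's first proposal and `D'` otherwise, and its tie-breaking mark
is uniform on `[0, 1]`. -/
def proposalLaw {K : ℕ} (D D' : Measure ℝ) (m : ℕ) (N : Fin K → ℕ) :
    Measure (Proposal N → Draw m) :=
  Measure.pi fun p : Proposal N =>
    (uniformOn (Set.univ : Set (Fin m))).prod
      ((if (p.1 : ℕ) = 0 then D else D').prod (volume.restrict (Set.Icc (0 : ℝ) 1)))

/-- In the outcome `ω`, the proposals `p` and `q` go to the same university, which ranks `q` above
`p`: higher signal first, equal signals being ordered by the tie-breaking mark. -/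
def Outranks {m : ℕ} {P : Type} (ω : P → Draw m) (q p : P) : Prop :=
  (ω q).1 = (ω p).1 ∧
    ((ω p).2.1 < (ω q).2.1 ∨ (ω p).2.1 = (ω q).2.1 ∧ (ω p).2.2 < (ω q).2.2)

/-- A proposal is accepted if it is among the `L` highest ranked ones that its university got. -/
def Accepted {m : ℕ} {P : Type} (L : ℕ) (ω : P → Draw m) (p : P) : Prop :=
  {q : P | Outranks ω q p}.ncard < L

/-- `acceptedFraction D D' M L n x i` times `n` is the expected number of accepted type `i` proposals
in a market of `n` students and `M n` universities with capacity `L` each, when `x j * n` proposals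
of type `j` are made for every `j`. (Numbers that are not integers are rounded.) -/
def acceptedFraction {K : ℕ} (D D' : Measure ℝ) (M : ℝ) (L n : ℕ) (x : Fin K → ℝ) (i : Fin K) : ℝ :=
  (∫ ω, ({a : Fin ⌊x i * n⌋₊ | Accepted L ω ⟨i, a⟩}.ncard : ℝ)
      ∂(proposalLaw D D' ⌈M * n⌉₊ fun j => ⌊x j * n⌋₊)) / n

/-- The system `y_i = y_{i-1} - f_{i-1}(y) ± o(1)`, `i = 1, …, K`, as `n → ∞`, with the conventions
`y_0 = 1` and `f_0 = 0`. The vector `y` may depend on `n`. With `0`-based indices, `y_i` is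
`y n (i-1)`, and `Fin.cons` puts the terms with index `0` in front. -/
def SolvesSystem {K : ℕ} (D D' : Measure ℝ) (M : ℝ) (L : ℕ) (y : ℕ → Fin K → ℝ) : Prop :=
  ∀ i : Fin K,
    (fun n : ℕ => y n i -
      ((Fin.cons 1 (y n) : Fin (K + 1) → ℝ) i.castSucc -
        (Fin.cons 0 (acceptedFraction D D' M L n (y n)) : Fin (K + 1) → ℝ) i.castSucc))
      =o[atTop] (fun _ => (1 : ℝ))

end ApplicationMarket

end

/-! Only two quantities matter in the limit: the numbers of first and of later proposals. A proposal
with marked signal `e` survives if fewer than `L` others at its university outrank it. That count is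
a sum of two independent binomials, with success probabilities `massAbove D e / m` and `massAbove D'
e / m`, and tends to a Poisson variable. Hence the accepted fraction of type `i` tends to `x i`
times a rate, even along converging vectors (`tendsto_acceptedFraction`).

In the limit the first entry is 1, and each later entry is the previous one times a rejection
probability: `1 - g S` once, then `1 - g' S`, where `S` is the sum of the later entries. Everything
reduces to the scalar equation S = (1 - g S) ∑_{i<k} (1 - g' S)^i. A solution exists by the
intermediate value theorem, but both sides increase in `S`, so uniqueness needs another idea:
counting accepted proposals in two ways. The total g S + S g' S depends on ranks only, not on `D`
and `D'`. It is the integral of `poissonTail L (u / M)` over [0, 1 + S], strictly increasing if `L ≠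
0` (`limitRate_add_mul`). At a solution the total also equals 1 - (1 - g S)(1 - g' S)^k, the share
of students ever accepted, which cannot increase with `S` because `g` and `g'` are antitone. So two
solutions cannot coexist.

Finally, limit points of solutions of the original system solve the limit system, and compactness of
the cube gives convergence. -/

noncomputable section

namespace ApplicationMarket

open Topology

/-! ### Binomial probabilities and their Poisson limit -/

/-- The probability that a binomial random variable with parameters `c` and `p` equals `k`. -/
def binomialWeight (c k : ℕ) (p : ℝ) : ℝ := c.choose k * p ^ k * (1 - p) ^ (c - k)

/-- The probability that the sum of two independent binomial random variables is less than `L`. -/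
def binomialSumTail (L c c' : ℕ) (p p' : ℝ) : ℝ :=
  ∑ k ∈ Finset.range L, ∑ x ∈ Finset.HasAntidiagonal.antidiagonal k,
    binomialWeight c x.1 p * binomialWeight c' x.2 p'

/-- The probability that a Poisson random variable with mean `r` is less than `L`. -/
def poissonTail (L : ℕ) (r : ℝ) : ℝ :=
  ∑ k ∈ Finset.range L, Real.exp (-r) * r ^ k / k.factorial

open Polynomial in
lemma coeff_linear_pow (c k : ℕ) (p : ℝ) :
    ((C (1 - p) + C p * X) ^ c : ℝ[X]).coeff k = binomialWeight c k p := by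
  rw [add_comm, add_pow, finsetSum_coeff]
  have h : ∀ i ∈ Finset.range (c + 1),
      ((C p * X) ^ i * C (1 - p) ^ (c - i) * (c.choose i : ℝ[X]) : ℝ[X]).coeff k =
        if i = k then binomialWeight c k p else 0 := by
    intro i _
    have : ((C p * X) ^ i * C (1 - p) ^ (c - i) * (c.choose i : ℝ[X]) : ℝ[X]) =
        C (p ^ i * (1 - p) ^ (c - i) * c.choose i) * X ^ i := by
      simp only [mul_pow, map_mul, map_pow, map_natCast]; ring
    rw [this, coeff_C_mul, coeff_X_pow]
    by_cases hik : i = k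
    · subst hik; simp [binomialWeight]; ring
    · simp [hik, Ne.symm hik]
  rw [Finset.sum_congr rfl h]
  by_cases hk : k < c + 1
  · simp [hk]
  · simp [binomialWeight, Nat.choose_eq_zero_of_lt (by omega : c < k)]

lemma binomialWeight_nonneg (c k : ℕ) {p : ℝ} (h0 : 0 ≤ p) (h1 : p ≤ 1) :
    0 ≤ binomialWeight c k p := by
  have : 0 ≤ 1 - p := by linarith
  unfold binomialWeight; positivity

lemma binomialWeight_le_one (c k : ℕ) {p : ℝ} (h0 : 0 ≤ p) (h1 : p ≤ 1) :
    binomialWeight c k p ≤ 1 := by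
  by_cases hk : k < c + 1
  · have h := add_pow p (1 - p) c
    have h2 := Finset.single_le_sum (s := Finset.range (c + 1))
      (f := fun i => binomialWeight c i p)
      (fun i _ => binomialWeight_nonneg c i h0 h1) (Finset.mem_range.2 hk)
    refine h2.trans (le_of_eq ?_)
    rw [show p + (1 - p) = 1 by ring, one_pow] at h
    rw [h]
    exact Finset.sum_congr rfl fun i _ => by unfold binomialWeight; ring
  · simp [binomialWeight, Nat.choose_eq_zero_of_lt (by omega : c < k)]

lemma abs_binomialSumTail_le (L c c' : ℕ) {p p' : ℝ} (h0 : 0 ≤ p) (h1 : p ≤ 1) (h0' : 0 ≤ p')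
    (h1' : p' ≤ 1) :
    |binomialSumTail L c c' p p'| ≤
      ∑ k ∈ Finset.range L, ∑ _x ∈ Finset.HasAntidiagonal.antidiagonal k, (1 : ℝ) := by
  unfold binomialSumTail
  rw [abs_of_nonneg]
  · refine Finset.sum_le_sum fun k _ => Finset.sum_le_sum fun x _ => ?_
    exact mul_le_one₀ (binomialWeight_le_one _ _ h0 h1) (binomialWeight_nonneg _ _ h0' h1')
      (binomialWeight_le_one _ _ h0' h1')
  · exact Finset.sum_nonneg fun k _ => Finset.sum_nonneg fun x _ =>
      mul_nonneg (binomialWeight_nonneg _ _ h0 h1) (binomialWeight_nonneg _ _ h0' h1')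

lemma continuous_binomialWeight (c k : ℕ) : Continuous (binomialWeight c k) := by
  unfold binomialWeight; fun_prop

lemma continuous_binomialSumTail (L c c' : ℕ) :
    Continuous fun p : ℝ × ℝ => binomialSumTail L c c' p.1 p.2 := by
  unfold binomialSumTail
  have := continuous_binomialWeight
  fun_prop

section Limit

variable {c c' : ℕ → ℕ} {p p' : ℕ → ℝ} {r r' : ℝ}

/-- Squeeze: log x ≥ 1 - 1/x and 1 - p ≤ exp (-p) give exp (-p/(1-p)) ≤ 1 - p ≤ exp (-p), then take
powers. -/
lemma tendsto_one_sub_pow (hp : Tendsto p atTop (𝓝 0))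
    (h : Tendsto (fun n => c n * p n) atTop (𝓝 r)) :
    Tendsto (fun n => (1 - p n) ^ c n) atTop (𝓝 (Real.exp (-r))) := by
  have hup : Tendsto (fun n => Real.exp (-(c n * p n))) atTop (𝓝 (Real.exp (-r))) :=
    (Real.continuous_exp.tendsto _).comp h.neg
  have hlo : Tendsto (fun n => Real.exp (-(c n * p n / (1 - p n)))) atTop
      (𝓝 (Real.exp (-r))) := by
    have h1 : Tendsto (fun n => c n * p n / (1 - p n)) atTop (𝓝 (r / (1 - 0))) :=
      h.div (hp.const_sub 1) (by norm_num)
    rw [sub_zero, div_one] at h1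
    exact (Real.continuous_exp.tendsto _).comp h1.neg
  have hlt : ∀ᶠ n in atTop, p n < 1 := hp.eventually_lt_const one_pos
  refine tendsto_of_tendsto_of_tendsto_of_le_of_le' hlo hup ?_ ?_
  · filter_upwards [hlt] with n hn
    have hpos : 0 < 1 - p n := by linarith
    have h1 := Real.one_sub_inv_le_log_of_pos hpos
    have h2 : Real.exp (-(p n / (1 - p n))) ≤ 1 - p n := by
      rw [← Real.le_log_iff_exp_le hpos]
      refine le_trans (le_of_eq ?_) h1
      field_simp; ring
    calc Real.exp (-(c n * p n / (1 - p n))) = Real.exp (-(p n / (1 - p n))) ^ c n := by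
          rw [← Real.exp_nat_mul]; congr 1; ring
      _ ≤ _ := pow_le_pow_left₀ (Real.exp_nonneg _) h2 _
  · filter_upwards [hlt] with n hn
    calc (1 - p n) ^ c n ≤ Real.exp (-p n) ^ c n :=
          pow_le_pow_left₀ (by linarith) (Real.one_sub_le_exp_neg _) _
      _ = _ := by rw [← Real.exp_nat_mul]; congr 1; ring

/-- Dropping boundedly many trials costs at most `i * p n`, which vanishes. This serves both the
factors of the falling factorial and the exclusion of the proposal under study from the count. -/
lemma tendsto_natSub_mul (hp0 : ∀ n, 0 ≤ p n) (hp : Tendsto p atTop (𝓝 0))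
    (h : Tendsto (fun n => c n * p n) atTop (𝓝 r)) (i : ℕ) :
    Tendsto (fun n => ((c n - i : ℕ) : ℝ) * p n) atTop (𝓝 r) := by
  have hlo : Tendsto (fun n => c n * p n - i * p n) atTop (𝓝 r) := by
    simpa using h.sub (hp.const_mul (i : ℝ))
  refine tendsto_of_tendsto_of_tendsto_of_le_of_le hlo h (fun n => ?_) (fun n => ?_)
  · have : (c n : ℝ) ≤ (c n - i : ℕ) + i := by exact_mod_cast (by omega)
    have := mul_le_mul_of_nonneg_right this (hp0 n)
    dsimp only; linarith
  · exact mul_le_mul_of_nonneg_right (Nat.cast_le.2 (Nat.sub_le _ _)) (hp0 n)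

lemma tendsto_binomialWeight (hp0 : ∀ n, 0 ≤ p n) (hp : Tendsto p atTop (𝓝 0))
    (h : Tendsto (fun n => c n * p n) atTop (𝓝 r)) (k : ℕ) :
    Tendsto (fun n => binomialWeight (c n) k (p n)) atTop
      (𝓝 (Real.exp (-r) * r ^ k / k.factorial)) := by
  have h1 : Tendsto (fun n => ∏ i ∈ Finset.range k, (((c n - i : ℕ) : ℝ) * p n)) atTop
      (𝓝 (∏ _i ∈ Finset.range k, r)) :=
    tendsto_finsetProd _ fun i _ => tendsto_natSub_mul hp0 hp h i
  have h2 := tendsto_one_sub_pow hp (tendsto_natSub_mul hp0 hp h k)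
  have h3 := (h2.mul h1).div_const (k.factorial : ℝ)
  rw [Finset.prod_const, Finset.card_range] at h3
  refine h3.congr fun n => ?_
  rw [Finset.prod_mul_distrib, Finset.prod_const, Finset.card_range, ← Nat.cast_prod,
    ← Nat.descFactorial_eq_prod_range, Nat.descFactorial_eq_factorial_mul_choose]
  unfold binomialWeight
  have := Nat.factorial_ne_zero k
  push_cast; field_simp

/-- The sum of independent Poisson variables is Poisson, by the binomial theorem. -/
lemma sum_antidiagonal_poisson (k : ℕ) (r r' : ℝ) :
    ∑ x ∈ Finset.HasAntidiagonal.antidiagonal k, (Real.exp (-r) * r ^ x.1 / x.1.factorial) *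
      (Real.exp (-r') * r' ^ x.2 / x.2.factorial) =
    Real.exp (-(r + r')) * (r + r') ^ k / k.factorial := by
  rw [(Commute.all r r').add_pow', Finset.mul_sum, Finset.sum_div]
  refine Finset.sum_congr rfl fun x hx => ?_
  have hx' := Finset.HasAntidiagonal.mem_antidiagonal.1 hx
  have hc : (k.choose x.1 : ℝ) = k.factorial / (x.1.factorial * x.2.factorial) := by
    rw [← hx', Nat.cast_add_choose]
  rw [nsmul_eq_mul, hc, neg_add, Real.exp_add]
  have := Nat.factorial_ne_zero k
  field_simp

lemma tendsto_binomialSumTail (hp0 : ∀ n, 0 ≤ p n) (hp : Tendsto p atTop (𝓝 0))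
    (h : Tendsto (fun n => c n * p n) atTop (𝓝 r))
    (hp0' : ∀ n, 0 ≤ p' n) (hp' : Tendsto p' atTop (𝓝 0))
    (h' : Tendsto (fun n => c' n * p' n) atTop (𝓝 r')) (L : ℕ) :
    Tendsto (fun n => binomialSumTail L (c n) (c' n) (p n) (p' n)) atTop
      (𝓝 (poissonTail L (r + r'))) := by
  unfold binomialSumTail poissonTail
  refine tendsto_finsetSum _ fun k _ => ?_
  rw [← sum_antidiagonal_poisson]
  exact tendsto_finsetSum _ fun x _ =>
    (tendsto_binomialWeight hp0 hp h _).mul (tendsto_binomialWeight hp0' hp' h' _)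

end Limit

lemma continuous_poissonTail (L : ℕ) : Continuous (poissonTail L) := by
  unfold poissonTail; fun_prop

/-- The derivatives of the Poisson weights telescope, leaving only the last one; its sign makes the
tail antitone. -/
lemma hasDerivAt_poissonTail_succ (L : ℕ) (r : ℝ) :
    HasDerivAt (poissonTail (L + 1)) (-(Real.exp (-r) * r ^ L / L.factorial)) r := by
  induction L with
  | zero =>
    have : poissonTail (0 + 1) = fun r => Real.exp (-r) := by ext; simp [poissonTail]
    rw [this]
    simpa using (hasDerivAt_id r).neg.exp
  | succ L ih =>
    have h : poissonTail (L + 1 + 1) = fun r => poissonTail (L + 1) r +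
        Real.exp (-r) * r ^ (L + 1) / (L + 1).factorial := by
      ext r; unfold poissonTail; rw [Finset.sum_range_succ]
    rw [h]
    have h1 := ih.add ((((hasDerivAt_id r).neg.exp).mul (hasDerivAt_pow (L + 1) r)).div_const
      ((L + 1).factorial : ℝ))
    refine h1.congr_deriv ?_
    rw [Nat.factorial_succ]
    have := Nat.factorial_ne_zero L

    push_cast
    field_simp
    simp
    ring

lemma antitoneOn_poissonTail (L : ℕ) : AntitoneOn (poissonTail L) (Set.Ici 0) := by
  cases L with
  | zero => intro a _ b _ _; simp [poissonTail]
  | succ L =>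
    refine antitoneOn_of_deriv_nonpos (convex_Ici 0) (continuous_poissonTail _).continuousOn
      (fun r _ => (hasDerivAt_poissonTail_succ L r).differentiableAt.differentiableWithinAt) ?_
    intro r hr
    rw [interior_Ici] at hr
    have : 0 < r := hr
    rw [(hasDerivAt_poissonTail_succ L r).deriv, neg_nonpos]
    positivity

lemma poissonTail_nonneg (L : ℕ) {r : ℝ} (hr : 0 ≤ r) : 0 ≤ poissonTail L r := by
  unfold poissonTail; positivity

lemma poissonTail_pos {L : ℕ} (hL : L ≠ 0) {r : ℝ} (hr : 0 ≤ r) : 0 < poissonTail L r := by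
  unfold poissonTail
  refine Finset.sum_pos' (fun k _ => by positivity)
    ⟨0, Finset.mem_range.2 (Nat.pos_of_ne_zero hL), ?_⟩
  simp [Real.exp_pos]

lemma poissonTail_le_one (L : ℕ) {r : ℝ} (hr : 0 ≤ r) : poissonTail L r ≤ 1 := by
  refine (antitoneOn_poissonTail L (Set.mem_Ici.2 le_rfl) hr hr).trans ?_
  unfold poissonTail
  cases L with
  | zero => simp
  | succ L => rw [Finset.sum_range_succ']; simp

/-! ### Marked signals and the probability integral transform -/

/-- The law of a signal together with its tie-breaking mark. -/
def markedLaw (P : Measure ℝ) : Measure (ℝ × ℝ) := P.prod (volume.restrict (Set.Icc (0 : ℝ) 1))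

/-- The marked signals that rank above `e`. -/
def above (e : ℝ × ℝ) : Set (ℝ × ℝ) := {e' | e.1 < e'.1 ∨ e.1 = e'.1 ∧ e.2 < e'.2}

/-- The mass of the marked signals that rank above `e`. -/
def massAbove (P : Measure ℝ) (e : ℝ × ℝ) : ℝ := (markedLaw P).real (above e)

instance isProbabilityMeasure_restrict_Icc :
    IsProbabilityMeasure (volume.restrict (Set.Icc (0 : ℝ) 1)) := ⟨by simp⟩

instance isFiniteMeasure_markedLaw (P : Measure ℝ) [IsFiniteMeasure P] :
    IsFiniteMeasure (markedLaw P) := by unfold markedLaw; infer_instance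

instance isProbabilityMeasure_markedLaw (P : Measure ℝ) [IsProbabilityMeasure P] :
    IsProbabilityMeasure (markedLaw P) := by unfold markedLaw; infer_instance

lemma measurableSet_above_prod :
    MeasurableSet {x : (ℝ × ℝ) × (ℝ × ℝ) | x.2 ∈ above x.1} := by
  unfold above
  have h1 : MeasurableSet {x : (ℝ × ℝ) × (ℝ × ℝ) | x.1.1 < x.2.1} :=
    measurableSet_lt (by fun_prop) (by fun_prop)
  have h2 : MeasurableSet {x : (ℝ × ℝ) × (ℝ × ℝ) | x.1.1 = x.2.1} :=
    measurableSet_eq_fun (by fun_prop) (by fun_prop)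
  have h3 : MeasurableSet {x : (ℝ × ℝ) × (ℝ × ℝ) | x.1.2 < x.2.2} :=
    measurableSet_lt (by fun_prop) (by fun_prop)
  exact h1.union (h2.inter h3)

lemma measurableSet_above (e : ℝ × ℝ) : MeasurableSet (above e) :=
  measurableSet_above_prod.preimage (measurable_prodMk_left (x := e))

lemma measurable_massAbove (P : Measure ℝ) [IsFiniteMeasure P] : Measurable (massAbove P) :=
  (measurable_measure_prodMk_left measurableSet_above_prod).ennreal_toReal

lemma massAbove_nonneg (P : Measure ℝ) (e : ℝ × ℝ) : 0 ≤ massAbove P e := measureReal_nonneg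

lemma massAbove_le_one (P : Measure ℝ) [IsProbabilityMeasure P] (e : ℝ × ℝ) :
    massAbove P e ≤ 1 := measureReal_le_one

/-- The uniform mark spreads an atom at `s` linearly, so ties leave no jumps in the distribution of
the mass above. -/
lemma massAbove_eq (P : Measure ℝ) [IsFiniteMeasure P] (s : ℝ) {t : ℝ}
    (ht : t ∈ Set.Icc (0 : ℝ) 1) :
    massAbove P (s, t) = P.real (Set.Ioi s) + P.real {s} * (1 - t) := by
  have h : above (s, t) = Set.Ioi s ×ˢ Set.univ ∪ {s} ×ˢ Set.Ioi t := by
    ext e; simp [above, eq_comm]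
  have hd : Disjoint (Set.Ioi s ×ˢ (Set.univ : Set ℝ)) ({s} ×ˢ Set.Ioi t) :=
    Set.disjoint_left.2 fun e he he' => by
      simp only [Set.mem_prod, Set.mem_Ioi, Set.mem_singleton_iff] at he he'
      exact absurd he'.1 he.1.ne'
  have hv : (volume.restrict (Set.Icc (0 : ℝ) 1)).real (Set.Ioi t) = 1 - t := by
    rw [measureReal_restrict_apply measurableSet_Ioi]
    have : Set.Ioi t ∩ Set.Icc 0 1 = Set.Ioc t 1 := by
      ext x; simp only [Set.mem_inter_iff, Set.mem_Ioi, Set.mem_Icc, Set.mem_Ioc]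
      have := ht.1
      constructor <;> rintro h <;> (refine ⟨?_, ?_⟩) <;> grind
    rw [this, Real.volume_real_Ioc_of_le ht.2]
  rw [massAbove, h, measureReal_union hd ((measurableSet_singleton s).prod measurableSet_Ioi),
    markedLaw, measureReal_prod_prod, measureReal_prod_prod, hv]
  simp

lemma ae_mem_Icc_markedLaw (P : Measure ℝ) [IsFiniteMeasure P] :
    ∀ᵐ e ∂markedLaw P, e.2 ∈ Set.Icc (0 : ℝ) 1 := by
  have h : ∀ᵐ t ∂(volume.restrict (Set.Icc (0 : ℝ) 1)), t ∈ Set.Icc (0 : ℝ) 1 :=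
    ae_restrict_mem measurableSet_Icc
  exact (Measure.quasiMeasurePreserving_snd (μ := P)).ae h

lemma measure_iUnion_nat_le {α : Type*} {mα : MeasurableSpace α} {μ : Measure α} {s : ℕ → Set α}
    (hs : Monotone s) {c : ENNReal} (h : ∀ n, μ (s n) ≤ c) : μ (⋃ n, s n) ≤ c := by
  rw [hs.measure_iUnion]; exact iSup_le h

/-- A point at which the decreasing function `s ↦ P (s, ∞)` crosses the level `u`. -/
lemma exists_crossing (P : Measure ℝ) [IsFiniteMeasure P] {u : ℝ} (h0 : 0 < u)
    (h1 : u < P.real Set.univ) :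
    ∃ s₀ : ℝ, P.real (Set.Ioi s₀) ≤ u ∧ u ≤ P.real (Set.Ici s₀) ∧
      ∀ s < s₀, u < P.real (Set.Ioi s) := by
  have hanti : Antitone fun s => P.real (Set.Ioi s) := fun a b hab =>
    measureReal_mono (Set.Ioi_subset_Ioi hab)
  have hIic : ∀ s, u ≤ P.real (Set.Ioi s) → P (Set.Iic s) ≤ ENNReal.ofReal (P.real Set.univ - u) := by
    intro s hs
    rw [← ofReal_measureReal (μ := P) (s := Set.Iic s)]
    apply ENNReal.ofReal_le_ofReal
    have := measureReal_compl (μ := P) (s := Set.Iic s) measurableSet_Iic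
    rw [Set.compl_Iic] at this
    linarith
  have hIoi : ∀ s, P.real (Set.Ioi s) ≤ u → P (Set.Ioi s) ≤ ENNReal.ofReal u := by
    intro s hs
    rw [← ofReal_measureReal (μ := P) (s := Set.Ioi s)]
    exact ENNReal.ofReal_le_ofReal hs
  -- The crossing point is `sInf A`. Continuity of the measure along half-lines shows that `A` is
  -- nonempty and bounded below, then transfers the bounds to the infimum from both sides.
  set A := {s : ℝ | P.real (Set.Ioi s) ≤ u} with hA
  have hne : A.Nonempty := by
    by_contra hemp
    rw [Set.not_nonempty_iff_eq_empty] at hemp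
    have hall : ∀ s, u < P.real (Set.Ioi s) := fun s => by
      by_contra hs
      have : s ∈ A := not_lt.1 hs
      simp [hemp] at this
    have := measure_iUnion_nat_le (μ := P) (s := fun n : ℕ => Set.Iic (n : ℝ))
      (fun a b hab => Set.Iic_subset_Iic.2 (by exact_mod_cast hab)) (fun n => hIic n (hall n).le)
    rw [show (⋃ n : ℕ, Set.Iic (n : ℝ)) = Set.univ from
      Set.eq_univ_of_forall fun x => Set.mem_iUnion.2 (exists_nat_ge x),
      ← ofReal_measureReal, ENNReal.ofReal_le_ofReal_iff (by linarith)] at this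
    linarith
  have hbdd : BddBelow A := by
    by_contra hb
    have hall : ∀ s, P.real (Set.Ioi s) ≤ u := fun s => by
      obtain ⟨x, hx, hxs⟩ := not_bddBelow_iff.1 hb s
      exact (hanti hxs.le).trans hx
    have := measure_iUnion_nat_le (μ := P) (s := fun n : ℕ => Set.Ioi (-(n : ℝ)))
      (fun a b hab => Set.Ioi_subset_Ioi (neg_le_neg (by exact_mod_cast hab)))
      (fun n => hIoi _ (hall _))
    rw [show (⋃ n : ℕ, Set.Ioi (-(n : ℝ))) = Set.univ from
      Set.eq_univ_of_forall fun x => Set.mem_iUnion.2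
        ((exists_nat_gt (-x)).imp fun n hn => by simp only [Set.mem_Ioi]; linarith),
      ← ofReal_measureReal, ENNReal.ofReal_le_ofReal_iff h0.le] at this
    linarith
  have hlt : ∀ s < sInf A, u < P.real (Set.Ioi s) := fun s hs =>
    not_le.1 fun h => notMem_of_lt_csInf hs hbdd h
  have hpos : ∀ n : ℕ, (0 : ℝ) < 1 / (n + 1) := fun n => Nat.one_div_pos_of_nat
  have hmono : ∀ a b : ℕ, a ≤ b → (1 : ℝ) / (b + 1) ≤ 1 / (a + 1) := fun a b hab =>
    Nat.one_div_le_one_div hab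
  refine ⟨sInf A, ?_, ?_, hlt⟩
  · have := measure_iUnion_nat_le (μ := P) (s := fun n : ℕ => Set.Ioi (sInf A + 1 / ((n : ℝ) + 1)))
      (fun a b hab => Set.Ioi_subset_Ioi (add_le_add_right (hmono a b hab) _))
      (c := ENNReal.ofReal u) (fun n => hIoi _ ?_)
    · rw [show (⋃ n : ℕ, Set.Ioi (sInf A + 1 / ((n : ℝ) + 1))) = Set.Ioi (sInf A) from ?_,
        ← ofReal_measureReal, ENNReal.ofReal_le_ofReal_iff h0.le] at this
      · exact this
      · ext x
        simp only [Set.mem_iUnion, Set.mem_Ioi]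
        constructor
        · rintro ⟨n, hn⟩; linarith [hpos n]
        · intro hx
          obtain ⟨n, hn⟩ := exists_nat_one_div_lt (sub_pos.2 hx)
          exact ⟨n, by linarith⟩
    · obtain ⟨x, hx, hxs⟩ := exists_lt_of_csInf_lt hne (lt_add_of_pos_right (sInf A) (hpos n))
      exact (hanti hxs.le).trans hx
  · have := measure_iUnion_nat_le (μ := P) (s := fun n : ℕ => Set.Iic (sInf A - 1 / ((n : ℝ) + 1)))
      (fun a b hab => Set.Iic_subset_Iic.2 (sub_le_sub_left (hmono a b hab) _))
      (fun n => hIic _ (hlt _ (sub_lt_self _ (hpos n))).le)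
    rw [show (⋃ n : ℕ, Set.Iic (sInf A - 1 / ((n : ℝ) + 1))) = Set.Iio (sInf A) from ?_,
        ← ofReal_measureReal, ENNReal.ofReal_le_ofReal_iff (by linarith)] at this
    · have h2 := measureReal_compl (μ := P) (s := Set.Iio (sInf A)) measurableSet_Iio
      rw [Set.compl_Iio] at h2
      linarith
    · ext x
      simp only [Set.mem_iUnion, Set.mem_Iic, Set.mem_Iio]
      constructor
      · rintro ⟨n, hn⟩; linarith [hpos n]
      · intro hx
        obtain ⟨n, hn⟩ := exists_nat_one_div_lt (sub_pos.2 hx)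
        exact ⟨n, by linarith⟩

/-- Up to a null set, the event consists of all signals beyond the crossing point `s₀` and, on a
possible atom at `s₀`, the marks in `V`; these fill exactly the missing mass. -/
lemma measure_massAbove_le (P : Measure ℝ) [IsFiniteMeasure P] {u : ℝ} (h0 : 0 < u)
    (h1 : u < P.real Set.univ) :
    markedLaw P {e | massAbove P e ≤ u} = ENNReal.ofReal u := by
  obtain ⟨s₀, hs1, hs2, hs3⟩ := exists_crossing P h0 h1
  have hsplit : ∀ s, P.real (Set.Ici s) = P.real (Set.Ioi s) + P.real {s} := fun s => by
    rw [← Set.Ioi_union_left, measureReal_union (by simp) (measurableSet_singleton s)]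
  set V := {t : ℝ | P.real (Set.Ioi s₀) + P.real {s₀} * (1 - t) ≤ u} with hV
  have hVm : MeasurableSet V := measurableSet_le (by fun_prop) (by fun_prop)
  have hae : {e | massAbove P e ≤ u} =ᵐ[markedLaw P]
      (Set.Ioi s₀ ×ˢ Set.univ ∪ {s₀} ×ˢ V : Set (ℝ × ℝ)) := by
    filter_upwards [ae_mem_Icc_markedLaw P] with e he
    obtain ⟨s, t⟩ := e
    have hm := massAbove_eq P s he
    have hp : 0 ≤ P.real {s} := measureReal_nonneg
    have ht0 : (0 : ℝ) ≤ t := he.1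
    have ht1 : t ≤ 1 := he.2
    apply propext
    change massAbove P (s, t) ≤ u ↔ (s, t) ∈ (Set.Ioi s₀ ×ˢ Set.univ ∪ {s₀} ×ˢ V : Set (ℝ × ℝ))
    simp only [Set.mem_union, Set.mem_prod, Set.mem_Ioi, Set.mem_univ, and_true,
      Set.mem_singleton_iff]
    rw [hm]
    rcases lt_trichotomy s s₀ with h | h | h
    · have h3 := hs3 s h
      have : 0 ≤ P.real {s} * (1 - t) := mul_nonneg hp (by linarith)
      constructor
      · intro h'; linarith
      · rintro (h' | h') <;> linarith
    · subst h; simp [hV]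
    · simp only [h, true_or, iff_true]
      have h4 : P.real (Set.Ici s) ≤ P.real (Set.Ioi s₀) :=
        measureReal_mono (Set.Ici_subset_Ioi.2 h)
      have := hsplit s
      nlinarith
  have hd : Disjoint (Set.Ioi s₀ ×ˢ (Set.univ : Set ℝ)) ({s₀} ×ˢ V) :=
    Set.disjoint_left.2 fun e he he' => by
      simp only [Set.mem_prod, Set.mem_Ioi, Set.mem_singleton_iff] at he he'
      exact absurd he'.1 he.1.ne'
  have hreal : (markedLaw P).real (Set.Ioi s₀ ×ˢ Set.univ ∪ {s₀} ×ˢ V : Set (ℝ × ℝ)) = u := by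
    rw [measureReal_union hd ((measurableSet_singleton s₀).prod hVm),
      markedLaw, measureReal_prod_prod, measureReal_prod_prod, probReal_univ, mul_one]
    have h5 := hsplit s₀
    -- Without an atom at `s₀` the two crossing inequalities already force the tail to equal `u`.
    rcases (measureReal_nonneg (μ := P) (s := {s₀})).eq_or_lt with h | h
    · rw [← h]; linarith
    · have hVI : V ∩ Set.Icc 0 1 = Set.Icc (1 - (u - P.real (Set.Ioi s₀)) / P.real {s₀}) 1 := by
        have hq1 : (u - P.real (Set.Ioi s₀)) / P.real {s₀} ≤ 1 := by
          rw [div_le_one h]; linarith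
        ext t
        have hiff : t ∈ V ↔ 1 - (u - P.real (Set.Ioi s₀)) / P.real {s₀} ≤ t := by
          rw [hV, Set.mem_ofPred_eq, sub_le_comm, le_div_iff₀ h]
          constructor <;> intro h' <;> linarith
        rw [Set.mem_inter_iff, hiff, Set.mem_Icc, Set.mem_Icc]
        constructor
        · exact fun h' => ⟨h'.1, h'.2.2⟩
        · exact fun h' => ⟨h'.1, by linarith [h'.1], h'.2⟩
      have hq0 : 0 ≤ (u - P.real (Set.Ioi s₀)) / P.real {s₀} := div_nonneg (by linarith) h.le
      rw [measureReal_restrict_apply hVm, hVI, Real.volume_real_Icc_of_le (by linarith)]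
      field_simp
      ring
  rw [measure_congr hae, ← ofReal_measureReal, hreal]

/-- The mass above a random marked signal is uniformly distributed. -/
lemma map_massAbove (P : Measure ℝ) [IsFiniteMeasure P] :
    (markedLaw P).map (massAbove P) = volume.restrict (Set.Icc 0 (P.real Set.univ)) := by
  have huniv : (markedLaw P) Set.univ = ENNReal.ofReal (P.real Set.univ) := by
    rw [markedLaw, ← Set.univ_prod_univ, Measure.prod_prod,
      measure_univ (μ := volume.restrict (Set.Icc (0 : ℝ) 1)), mul_one,
      ofReal_measureReal]
  have hle : ∀ᵐ e ∂markedLaw P, massAbove P e ≤ P.real Set.univ := by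
    refine ae_of_all _ fun e => ?_
    refine (measureReal_mono (Set.subset_univ _)).trans (le_of_eq ?_)
    rw [measureReal_def, huniv, ENNReal.toReal_ofReal measureReal_nonneg]
  have hpos : ∀ u : ℝ, 0 < u → (markedLaw P).map (massAbove P) (Set.Iic u) =
      volume.restrict (Set.Icc 0 (P.real Set.univ)) (Set.Iic u) := by
    intro u hu
    rw [Measure.map_apply (measurable_massAbove P) measurableSet_Iic,
      Measure.restrict_apply measurableSet_Iic]
    rcases lt_or_ge u (P.real Set.univ) with h | h
    · have : Set.Iic u ∩ Set.Icc 0 (P.real Set.univ) = Set.Icc 0 u := by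
        ext x; simp only [Set.mem_inter_iff, Set.mem_Iic, Set.mem_Icc]
        constructor
        · exact fun h' => ⟨h'.2.1, h'.1⟩
        · exact fun h' => ⟨h'.2, h'.1, by linarith [h'.2]⟩
      rw [this, Real.volume_Icc, sub_zero]
      exact measure_massAbove_le P hu h
    · have : Set.Iic u ∩ Set.Icc 0 (P.real Set.univ) = Set.Icc 0 (P.real Set.univ) :=
        Set.inter_eq_right.2 fun x hx => hx.2.trans h
      rw [this, Real.volume_Icc, sub_zero, ← huniv]
      apply measure_congr
      filter_upwards [hle] with e he
      exact propext ⟨fun _ => trivial, fun _ => he.trans h⟩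
  refine Measure.ext_of_Iic _ _ fun u => ?_
  rcases lt_or_ge 0 u with hu | hu
  · exact hpos u hu
  -- For `u ≤ 0` both measures vanish on `Iic u`, being at most `ε` on `Iic ε` for every `ε > 0`.
  · have hzero : ∀ ε : NNReal, 0 < ε →
        volume.restrict (Set.Icc 0 (P.real Set.univ)) (Set.Iic (ε : ℝ)) ≤ ε := by
      intro ε _
      rw [Measure.restrict_apply measurableSet_Iic]
      calc volume (Set.Iic (ε : ℝ) ∩ Set.Icc 0 (P.real Set.univ)) ≤ volume (Set.Icc (0 : ℝ) ε) :=
            measure_mono fun x hx => ⟨hx.2.1, hx.1⟩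
        _ = ε := by rw [Real.volume_Icc, sub_zero, ENNReal.ofReal_coe_nnreal]
    have hsub : ∀ ε : NNReal, Set.Iic u ⊆ Set.Iic (ε : ℝ) := fun ε =>
      Set.Iic_subset_Iic.2 (hu.trans ε.2)
    have key : ∀ μ : Measure ℝ, (∀ ε : NNReal, 0 < ε → μ (Set.Iic (ε : ℝ)) ≤ ε) →
        μ (Set.Iic u) = 0 := by
      intro μ hμ
      refine le_antisymm (ENNReal.le_of_forall_pos_le_add fun ε hε _ => ?_) zero_le
      rw [zero_add]
      exact (measure_mono (hsub ε)).trans (hμ ε hε)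
    rw [key _ hzero, key _ fun ε hε => (hpos ε hε).trans_le (hzero ε hε)]

/-! ### Limiting acceptance rates -/

/-- The limiting probability that a proposal with signal law `P` is accepted, when `x n` proposals
have signal law `D` and `S n` have signal law `D'`. -/
def limitRate (D D' : Measure ℝ) (M : ℝ) (L : ℕ) (P : Measure ℝ) (x S : ℝ) : ℝ :=
  ∫ e, poissonTail L ((x * massAbove D e + S * massAbove D' e) / M) ∂markedLaw P

lemma mean_nonneg {D D' : Measure ℝ} {M : ℝ} (hM : 0 < M) {x S : ℝ} (hx : 0 ≤ x) (hS : 0 ≤ S) (e : ℝ × ℝ) :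
    0 ≤ (x * massAbove D e + S * massAbove D' e) / M := by
  have := massAbove_nonneg D e
  have := massAbove_nonneg D' e
  positivity

lemma limitRate_nonneg {D D' : Measure ℝ} {M : ℝ} (P : Measure ℝ) (hM : 0 < M) (L : ℕ) {x S : ℝ} (hx : 0 ≤ x) (hS : 0 ≤ S) :
    0 ≤ limitRate D D' M L P x S :=
  integral_nonneg fun e => poissonTail_nonneg L (mean_nonneg hM hx hS e)

lemma norm_poissonTail_mean_le {D D' : Measure ℝ} {M : ℝ} (hM : 0 < M) (L : ℕ) {x S : ℝ} (hx : 0 ≤ x) (hS : 0 ≤ S)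
    (e : ℝ × ℝ) : ‖poissonTail L ((x * massAbove D e + S * massAbove D' e) / M)‖ ≤ 1 := by
  have h := mean_nonneg (D := D) (D' := D') hM hx hS e
  rw [Real.norm_of_nonneg (poissonTail_nonneg L h)]
  exact poissonTail_le_one L h

section Rate

variable {D D' : Measure ℝ} [IsProbabilityMeasure D] [IsProbabilityMeasure D'] {M : ℝ}

lemma measurable_poissonTail_mean (L : ℕ) (x S : ℝ) :
    Measurable fun e => poissonTail L ((x * massAbove D e + S * massAbove D' e) / M) := by
  have := measurable_massAbove D
  have := measurable_massAbove D'
  exact (continuous_poissonTail L).measurable.comp (by fun_prop)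

lemma integrable_poissonTail_mean (hM : 0 < M) (L : ℕ) {x S : ℝ} (hx : 0 ≤ x) (hS : 0 ≤ S)
    (P : Measure ℝ) [IsProbabilityMeasure P] :
    Integrable (fun e => poissonTail L ((x * massAbove D e + S * massAbove D' e) / M))
      (markedLaw P) :=
  Integrable.of_bound (measurable_poissonTail_mean L x S).aestronglyMeasurable 1
    (ae_of_all _ (norm_poissonTail_mean_le hM L hx hS))

variable (P : Measure ℝ) [IsProbabilityMeasure P]

lemma limitRate_le_one (hM : 0 < M) (L : ℕ) {x S : ℝ} (hx : 0 ≤ x) (hS : 0 ≤ S) :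
    limitRate D D' M L P x S ≤ 1 := by
  refine (integral_mono (integrable_poissonTail_mean hM L hx hS P) (integrable_const (1 : ℝ))
    fun e => poissonTail_le_one L (mean_nonneg hM hx hS e)).trans ?_
  simp

lemma antitoneOn_limitRate (hM : 0 < M) (L : ℕ) {x : ℝ} (hx : 0 ≤ x) :
    AntitoneOn (limitRate D D' M L P x) (Set.Ici 0) := by
  intro a ha b hb hab
  refine integral_mono (integrable_poissonTail_mean hM L hx hb P)
    (integrable_poissonTail_mean hM L hx ha P) fun e => ?_
  refine antitoneOn_poissonTail L (mean_nonneg hM hx ha e) (mean_nonneg hM hx hb e) ?_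
  have := massAbove_nonneg D' e
  gcongr

lemma continuousOn_limitRate (hM : 0 < M) (L : ℕ) {x : ℝ} (hx : 0 ≤ x) :
    ContinuousOn (limitRate D D' M L P x) (Set.Ici 0) := by
  refine continuousOn_of_dominated (bound := fun _ => 1)
    (fun S _ => (measurable_poissonTail_mean L x S).aestronglyMeasurable)
    (fun S hS => ae_of_all _ (norm_poissonTail_mean_le hM L hx hS)) (integrable_const _)
    (ae_of_all _ fun e => ?_)
  exact ((continuous_poissonTail L).comp (by fun_prop)).continuousOn

lemma markedLaw_mix (D D' : Measure ℝ) [IsProbabilityMeasure D] [IsProbabilityMeasure D'] (S : ℝ) :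
    markedLaw (D + ENNReal.ofReal S • D') = markedLaw D + ENNReal.ofReal S • markedLaw D' := by
  unfold markedLaw
  rw [Measure.add_prod, Measure.prod_smul_left]

/-- The limiting number of accepted proposals depends only on the total number of proposals. -/
lemma limitRate_add_mul (hM : 0 < M) (L : ℕ) {S : ℝ} (hS : 0 ≤ S) :
    limitRate D D' M L D 1 S + S * limitRate D D' M L D' 1 S =
      ∫ u in (0 : ℝ)..(1 + S), poissonTail L (u / M) := by
  have : IsFiniteMeasure (ENNReal.ofReal S • D') := Measure.smul_finite _ ENNReal.ofReal_ne_top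
  -- The Poisson mean is the mass above `e` under the mixture D + S·D', divided by `M`. Both terms
  -- thus merge into one integral against the marked mixture, where that mass is uniform on [0, 1 +
  -- S].
  have hmass : ∀ e, massAbove (D + ENNReal.ofReal S • D') e =
      1 * massAbove D e + S * massAbove D' e := fun e => by
    have : IsFiniteMeasure (ENNReal.ofReal S • markedLaw D') :=
      Measure.smul_finite _ ENNReal.ofReal_ne_top
    rw [massAbove, markedLaw_mix, measureReal_add_apply, measureReal_ennreal_smul_apply,
      ENNReal.toReal_ofReal hS, one_mul, massAbove, massAbove]
  have huniv : (D + ENNReal.ofReal S • D').real Set.univ = 1 + S := by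
    rw [measureReal_add_apply, measureReal_ennreal_smul_apply, ENNReal.toReal_ofReal hS]
    simp
  have hint := integrable_poissonTail_mean (D := D) (D' := D') hM L zero_le_one hS D
  have hint' := integrable_poissonTail_mean (D := D) (D' := D') hM L zero_le_one hS D'
  have hc : Continuous fun u => poissonTail L (u / M) :=
    (continuous_poissonTail L).comp (by fun_prop)
  rw [intervalIntegral.integral_of_le (by linarith), ← integral_Icc_eq_integral_Ioc, ← huniv,
    ← map_massAbove, integral_map (measurable_massAbove _).aemeasurable
      hc.aestronglyMeasurable, markedLaw_mix]
  simp only [hmass]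
  rw [integral_add_measure hint (hint'.smul_measure ENNReal.ofReal_ne_top), integral_smul_measure,
    ENNReal.toReal_ofReal hS, smul_eq_mul, limitRate, limitRate]

lemma strictMonoOn_limitRate_add_mul (hM : 0 < M) {L : ℕ} (hL : L ≠ 0) :
    StrictMonoOn (fun S => limitRate D D' M L D 1 S + S * limitRate D D' M L D' 1 S)
      (Set.Ici 0) := by
  intro a ha b hb hab
  have ha0 : 0 ≤ a := ha
  simp only [limitRate_add_mul hM L ha, limitRate_add_mul hM L hb]
  have hc : Continuous fun u => poissonTail L (u / M) :=
    (continuous_poissonTail L).comp (by fun_prop)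
  rw [← intervalIntegral.integral_add_adjacent_intervals (hc.intervalIntegrable 0 (1 + a))
    (hc.intervalIntegrable (1 + a) (1 + b)), lt_add_iff_pos_right]
  refine intervalIntegral.intervalIntegral_pos_of_pos_on (hc.intervalIntegrable _ _)
    (fun u hu => poissonTail_pos hL ?_) (by linarith)
  have : 0 < u := by linarith [hu.1]
  positivity

end Rate

/-! ### The scalar fixed-point equation -/

/-- If first proposals are accepted at the rate `g S` and later ones at the rate `g' S`, where `S` is
the number of later proposals, then exactly one `S` is consistent with these rates. -/
lemma existsUnique_fixedPoint (k : ℕ) {g g' : ℝ → ℝ}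
    (hg : ContinuousOn g (Set.Ici 0)) (hg' : ContinuousOn g' (Set.Ici 0))
    (h0 : ∀ S, 0 ≤ S → 0 ≤ g S) (h1 : ∀ S, 0 ≤ S → g S ≤ 1)
    (h0' : ∀ S, 0 ≤ S → 0 ≤ g' S) (h1' : ∀ S, 0 ≤ S → g' S ≤ 1)
    (ha : AntitoneOn g (Set.Ici 0)) (ha' : AntitoneOn g' (Set.Ici 0))
    (hs : StrictMonoOn (fun S => g S + S * g' S) (Set.Ici 0) ∨ ∀ S, g S = 0 ∧ g' S = 0) :
    ∃! S, 0 ≤ S ∧ (1 - g S) * ∑ i ∈ Finset.range k, (1 - g' S) ^ i = S := by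
  have hub : ∀ S, 0 ≤ S → (1 - g S) * ∑ i ∈ Finset.range k, (1 - g' S) ^ i ≤ k := by
    intro S hS
    have hsum : ∑ i ∈ Finset.range k, (1 - g' S) ^ i ≤ k := by
      refine (Finset.sum_le_card_nsmul _ _ 1 fun i _ => ?_).trans (by simp)
      exact pow_le_one₀ (by linarith [h1' S hS]) (by linarith [h0' S hS])
    have hsum0 : 0 ≤ ∑ i ∈ Finset.range k, (1 - g' S) ^ i :=
      Finset.sum_nonneg fun i _ => pow_nonneg (by linarith [h1' S hS]) _
    nlinarith [h0 S hS, h1 S hS]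
  have hlb : 0 ≤ (1 - g 0) * ∑ i ∈ Finset.range k, (1 - g' 0) ^ i :=
    mul_nonneg (by linarith [h1 0 le_rfl])
      (Finset.sum_nonneg fun i _ => pow_nonneg (by linarith [h1' 0 le_rfl]) _)
  have hc : ContinuousOn (fun S => S - (1 - g S) * ∑ i ∈ Finset.range k, (1 - g' S) ^ i)
      (Set.Icc 0 k) := by
    have e1 := hg.mono (Set.Icc_subset_Ici_self : Set.Icc 0 (k : ℝ) ⊆ _)
    have e2 := hg'.mono (Set.Icc_subset_Ici_self : Set.Icc 0 (k : ℝ) ⊆ _)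
    fun_prop
  obtain ⟨S, hS, hS'⟩ := intermediate_value_Icc (Nat.cast_nonneg k) hc
    (show (0 : ℝ) ∈ Set.Icc _ _ from
      ⟨by simpa using hlb, by simpa using hub k (Nat.cast_nonneg k)⟩)
  refine existsUnique_of_exists_of_unique ⟨S, hS.1, by simp only at hS'; linarith⟩ ?_
  rcases hs with hs | hs
  -- At a fixed point the geometric sum collapses: accepted proposals number one minus the students
  -- rejected in every round.
  · have htotal : ∀ S, (1 - g S) * ∑ i ∈ Finset.range k, (1 - g' S) ^ i = S →
        g S + S * g' S = 1 - (1 - g S) * (1 - g' S) ^ k := by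
      intro S hS
      have hgeom := geom_sum_mul_neg (1 - g' S) k
      rw [sub_sub_cancel] at hgeom
      have : S * g' S = (1 - g S) * (1 - (1 - g' S) ^ k) := by
        rw [← hgeom, ← mul_assoc, hS]
      rw [this]; ring
    -- For fixed points `a < b` the left side of `htotal` strictly increases, while antitone rates
    -- keep its right side from increasing.
    have hlt : ∀ a b, 0 ≤ a → a < b → (1 - g a) * ∑ i ∈ Finset.range k, (1 - g' a) ^ i = a →
        (1 - g b) * ∑ i ∈ Finset.range k, (1 - g' b) ^ i = b → False := by
      intro a b h hab e1 e2
      have hb : 0 ≤ b := h.trans hab.le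
      have e3 := hs h hb hab
      simp only [htotal a e1, htotal b e2] at e3
      have e4 : (1 - g a) * (1 - g' a) ^ k ≤ (1 - g b) * (1 - g' b) ^ k := by
        have := ha h hb hab.le
        have := ha' h hb hab.le
        refine mul_le_mul (by linarith) (pow_le_pow_left₀ (by linarith [h1' a h]) (by linarith) _)
          (pow_nonneg (by linarith [h1' a h]) _) (by linarith [h1 b hb])
      linarith
    rintro a b ⟨h, e1⟩ ⟨h', e2⟩
    rcases lt_trichotomy a b with hab | hab | hab
    · exact (hlt a b h hab e1 e2).elim
    · exact hab
    · exact (hlt b a h' hab e2 e1).elim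
  -- With vanishing rates the fixed-point map is constant.
  · rintro a b ⟨_, e1⟩ ⟨_, e2⟩
    rw [← e1, ← e2, (hs a).1, (hs a).2, (hs b).1, (hs b).2]

/-! ### The limit system -/

/-- The number of first proposals, as a multiple of the number of students. -/
def firstSum {K : ℕ} (x : Fin K → ℝ) : ℝ := ∑ j : Fin K, if (j : ℕ) = 0 then x j else 0

/-- The number of later proposals, as a multiple of the number of students. -/
def laterSum {K : ℕ} (x : Fin K → ℝ) : ℝ := ∑ j : Fin K, if (j : ℕ) = 0 then 0 else x j

/-- The limit of `acceptedFraction`. -/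
def limitFraction {K : ℕ} (D D' : Measure ℝ) (M : ℝ) (L : ℕ) (x : Fin K → ℝ) (i : Fin K) : ℝ :=
  x i * limitRate D D' M L (if (i : ℕ) = 0 then D else D') (firstSum x) (laterSum x)

/-- The limit of the system of equations. -/
def SolvesLimitSystem {K : ℕ} (D D' : Measure ℝ) (M : ℝ) (L : ℕ) (y : Fin K → ℝ) : Prop :=
  ∀ i : Fin K, y i = (Fin.cons 1 y : Fin (K + 1) → ℝ) i.castSucc -
    (Fin.cons 0 (limitFraction D D' M L y) : Fin (K + 1) → ℝ) i.castSucc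

lemma firstSum_succ {k : ℕ} (x : Fin (k + 1) → ℝ) : firstSum x = x 0 := by
  simp [firstSum]

lemma laterSum_succ {k : ℕ} (x : Fin (k + 1) → ℝ) : laterSum x = ∑ j : Fin k, x j.succ := by
  simp [laterSum, Fin.sum_univ_succ]

/-- Each equation multiplies the previous entry by a rejection probability, so the solution is
geometric from the second entry on. The vector enters the right side only through `laterSum y`,
which leaves one unknown. -/
lemma solvesLimitSystem_succ_iff {k : ℕ} {D D' : Measure ℝ} {M : ℝ} {L : ℕ}
    {y : Fin (k + 1) → ℝ} : SolvesLimitSystem D D' M L y ↔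
      y = Fin.cons 1 fun j : Fin k => (1 - limitRate D D' M L D 1 (laterSum y)) *
        (1 - limitRate D D' M L D' 1 (laterSum y)) ^ (j : ℕ) := by
  have hsys : SolvesLimitSystem D D' M L y ↔ y 0 = 1 ∧ ∀ j : Fin k, y j.succ = y j.castSucc *
      (1 - limitRate D D' M L (if (j : ℕ) = 0 then D else D') (firstSum y) (laterSum y)) := by
    rw [SolvesLimitSystem, Fin.forall_fin_succ]
    simp only [← Fin.succ_castSucc, Fin.cons_succ, Fin.castSucc_zero, Fin.cons_zero, sub_zero,
      limitFraction, Fin.val_castSucc, mul_sub, mul_one]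
  rw [hsys]
  constructor
  · rintro ⟨h0, hs⟩
    rw [firstSum_succ, h0] at hs
    have hval : ∀ n (hn : n < k), y (Fin.succ ⟨n, hn⟩) =
        (1 - limitRate D D' M L D 1 (laterSum y)) *
          (1 - limitRate D D' M L D' 1 (laterSum y)) ^ n := by
      intro n
      induction n with
      | zero =>
        intro hn
        rw [hs]
        have : (Fin.castSucc ⟨0, hn⟩ : Fin (k + 1)) = 0 := rfl
        simp [this, h0]
      | succ n ih =>
        intro hn
        rw [hs]
        have : (Fin.castSucc ⟨n + 1, hn⟩ : Fin (k + 1)) = Fin.succ ⟨n, by omega⟩ := rfl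
        rw [this, ih]
        simp only [Nat.add_eq_zero_iff, one_ne_zero, and_false, if_false]
        ring
    funext i
    refine Fin.cases h0 (fun j => ?_) i
    exact hval j j.2
  · intro h
    have h0 : y 0 = 1 := by rw [h]; rfl
    have hval : ∀ j : Fin k, y j.succ = (1 - limitRate D D' M L D 1 (laterSum y)) *
        (1 - limitRate D D' M L D' 1 (laterSum y)) ^ (j : ℕ) := fun j => congrFun h j.succ
    refine ⟨h0, fun j => ?_⟩
    rw [firstSum_succ, h0, hval]
    obtain ⟨n, hn⟩ := j
    cases n with
    | zero =>
      have : (Fin.castSucc ⟨0, hn⟩ : Fin (k + 1)) = 0 := rfl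
      simp [this, h0]
    | succ n =>
      have : (Fin.castSucc ⟨n + 1, hn⟩ : Fin (k + 1)) = Fin.succ ⟨n, by omega⟩ := rfl
      rw [this, hval]
      simp only [Nat.add_eq_zero_iff, one_ne_zero, and_false, if_false]
      ring

theorem existsUnique_solvesLimitSystem (K L : ℕ) {M : ℝ} (hM : 0 < M) (D D' : Measure ℝ)
    [IsProbabilityMeasure D] [IsProbabilityMeasure D'] :
    ∃! y : Fin K → ℝ, y ∈ Set.Icc (0 : Fin K → ℝ) 1 ∧ SolvesLimitSystem D D' M L y := by
  cases K with
  | zero =>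
    exact ⟨0, ⟨⟨fun i => i.elim0, fun i => i.elim0⟩, fun i => i.elim0⟩,
      fun y _ => Subsingleton.elim _ _⟩
  | succ k =>
    set g := limitRate D D' M L D 1
    set g' := limitRate D D' M L D' 1
    have h0 : ∀ S, 0 ≤ S → 0 ≤ g S := fun S => limitRate_nonneg D hM L zero_le_one
    have h1 : ∀ S, 0 ≤ S → g S ≤ 1 := fun S => limitRate_le_one D hM L zero_le_one
    have h0' : ∀ S, 0 ≤ S → 0 ≤ g' S := fun S => limitRate_nonneg D' hM L zero_le_one
    have h1' : ∀ S, 0 ≤ S → g' S ≤ 1 := fun S => limitRate_le_one D' hM L zero_le_one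
    have hfix := existsUnique_fixedPoint k (continuousOn_limitRate D hM L zero_le_one)
      (continuousOn_limitRate D' hM L zero_le_one) h0 h1 h0' h1'
      (antitoneOn_limitRate D hM L zero_le_one) (antitoneOn_limitRate D' hM L zero_le_one) ?_
    · obtain ⟨S, ⟨hS, hSfix⟩, hSuniq⟩ := hfix
      have hlater : ∀ T, laterSum (Fin.cons 1 fun j : Fin k => (1 - g T) * (1 - g' T) ^ (j : ℕ) :
          Fin (k + 1) → ℝ) = (1 - g T) * ∑ i ∈ Finset.range k, (1 - g' T) ^ i := by
        intro T
        rw [laterSum_succ]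
        simp only [Fin.cons_succ]
        rw [← Finset.mul_sum, Fin.sum_univ_eq_sum_range (fun i => (1 - g' T) ^ i)]
      refine ⟨Fin.cons 1 fun j : Fin k => (1 - g S) * (1 - g' S) ^ (j : ℕ), ⟨⟨?_, ?_⟩, ?_⟩, ?_⟩
      · intro i
        refine Fin.cases (by simp) (fun j => ?_) i
        exact mul_nonneg (by linarith [h1 S hS]) (pow_nonneg (by linarith [h1' S hS]) _)
      · intro i
        refine Fin.cases (by simp) (fun j => ?_) i
        exact mul_le_one₀ (by linarith [h0 S hS]) (pow_nonneg (by linarith [h1' S hS]) _)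
          (pow_le_one₀ (by linarith [h1' S hS]) (by linarith [h0' S hS]))
      · rw [solvesLimitSystem_succ_iff, hlater, hSfix]
      · rintro y ⟨hy, hsol⟩
        rw [solvesLimitSystem_succ_iff] at hsol
        have hT : laterSum y = S := by
          refine hSuniq _ ⟨?_, ?_⟩
          · rw [laterSum_succ]
            exact Finset.sum_nonneg fun j _ => hy.1 j.succ
          · rw [← hlater, ← hsol]
        rw [hsol, hT]
    · by_cases hL : L = 0
      -- With zero capacity `poissonTail` is an empty sum, so both rates vanish.
      · right
        subst hL
        exact fun S => by simp [limitRate, poissonTail]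
      · exact Or.inl (strictMonoOn_limitRate_add_mul hM hL)

/-! ### Counting independent events -/

section Product

variable {ι E : Type*} [Fintype ι] {mE : MeasurableSpace E}
  (μ : ι → Measure E) [∀ i, IsProbabilityMeasure (μ i)]

/-- Resampling one coordinate does not change a product law. -/
lemma map_update_prod_pi [DecidableEq ι] (p : ι) :
    ((μ p).prod (Measure.pi μ)).map (fun x => Function.update x.2 p x.1) = Measure.pi μ := by
  have hmeas : Measurable fun x : E × (ι → E) => Function.update x.2 p x.1 :=
    measurable_update'.comp measurable_swap
  refine (Measure.pi_eq fun s hs => ?_).symm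
  rw [Measure.map_apply hmeas (MeasurableSet.univ_pi hs)]
  have hpre : (fun x : E × (ι → E) => Function.update x.2 p x.1) ⁻¹' Set.univ.pi s =
      s p ×ˢ Set.univ.pi (Function.update s p Set.univ) := by
    ext x
    simp only [Set.mem_preimage, Set.mem_univ_pi, Set.mem_prod]
    constructor
    · intro h
      refine ⟨by simpa using h p, fun q => ?_⟩
      by_cases hq : q = p
      · subst hq; simp
      · simpa [hq] using h q
    · rintro ⟨h1, h2⟩ q
      by_cases hq : q = p
      · subst hq; simpa using h1
      · simpa [hq] using h2 q
  rw [hpre, Measure.prod_prod, Measure.pi_pi, ← Finset.mul_prod_erase _ _ (Finset.mem_univ p),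
    ← Finset.mul_prod_erase (Finset.univ) (fun i => μ i (s i)) (Finset.mem_univ p)]
  simp only [Function.update_self, measure_univ, one_mul]
  congr 1
  refine Finset.prod_congr rfl fun q hq => ?_
  rw [Function.update_of_ne (Finset.ne_of_mem_erase hq)]

open Polynomial in
/-- The probability generating function of a number of independent events. -/
lemma measureReal_ncard_eq (B : ι → Set E) (hB : ∀ i, MeasurableSet (B i)) (k : ℕ) :
    MeasurableSet {ω : ι → E | {i | ω i ∈ B i}.ncard = k} ∧
    (Measure.pi μ).real {ω | {i | ω i ∈ B i}.ncard = k} =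
      (∏ i, (C (1 - (μ i).real (B i)) + C ((μ i).real (B i)) * X) : ℝ[X]).coeff k := by
  classical
  have hncard : ∀ ω : ι → E, {i | ω i ∈ B i}.ncard = ∑ i, if ω i ∈ B i then 1 else 0 := by
    intro ω
    rw [Set.ncard_eq_toFinset_card', Finset.sum_boole]
    simp
  have hmN : Measurable fun ω : ι → E => {i | ω i ∈ B i}.ncard := by
    simp only [hncard]
    exact Finset.measurable_sum _ fun i _ => Measurable.ite
      ((hB i).preimage (measurable_pi_apply i)) measurable_const measurable_const
  have hms : ∀ k, MeasurableSet {ω : ι → E | {i | ω i ∈ B i}.ncard = k} := fun k =>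
    hmN (measurableSet_singleton k)
  refine ⟨hms k, ?_⟩
  have hlt : ∀ ω : ι → E, {i | ω i ∈ B i}.ncard < Fintype.card ι + 1 := fun ω =>
    Nat.lt_succ_of_le ((Set.ncard_le_ncard (Set.subset_univ _)).trans
      (by rw [Set.ncard_univ, Nat.card_eq_fintype_card]))
  have hpoly : ∑ k ∈ Finset.range (Fintype.card ι + 1),
      C ((Measure.pi μ).real {ω | {i | ω i ∈ B i}.ncard = k}) * X ^ k =
      ∏ i, (C (1 - (μ i).real (B i)) + C ((μ i).real (B i)) * X) := by
    -- Both polynomials evaluate at `r` to the expectation of `r` to the number of events that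
    -- occur; independence turns it into the product.
    refine Polynomial.funext fun r => ?_
    simp only [eval_finsetSum, eval_prod, eval_add, eval_mul, eval_C, eval_pow, eval_X]
    have h1 : ∀ i, ∫ x, (if x ∈ B i then r else 1) ∂μ i =
        1 - (μ i).real (B i) + (μ i).real (B i) * r := by
      intro i
      have : (fun x => if x ∈ B i then r else 1) =
          fun x => 1 + (B i).indicator (fun _ => r - 1) x := by
        ext x; by_cases hx : x ∈ B i <;> simp [hx]
      rw [this, integral_add (integrable_const _) ((integrable_const _).indicator (hB i)),
        integral_indicator_const _ (hB i)]
      simp only [integral_const, probReal_univ, smul_eq_mul]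
      ring
    simp only [← h1]
    rw [← integral_fintype_prod_eq_prod]
    have h2 : ∀ ω : ι → E, ∏ i, (if ω i ∈ B i then r else 1) =
        ∑ k ∈ Finset.range (Fintype.card ι + 1),
          {ω : ι → E | {i | ω i ∈ B i}.ncard = k}.indicator (fun _ => r ^ k) ω := by
      intro ω
      have : ∀ i, (if ω i ∈ B i then r else 1) = r ^ (if ω i ∈ B i then 1 else 0) := fun i => by
        split_ifs <;> simp
      simp only [this]
      rw [Finset.prod_pow_eq_pow_sum, ← hncard]
      simp only [Set.indicator_apply, Set.mem_ofPred_eq]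
      rw [Finset.sum_ite_eq, if_pos (Finset.mem_range.2 (hlt ω))]
    simp only [h2]
    rw [integral_finsetSum _ fun k _ => (integrable_const _).indicator (hms k)]
    refine Finset.sum_congr rfl fun k _ => ?_
    rw [integral_indicator_const _ (hms k), smul_eq_mul]
  rw [← hpoly, finsetSum_coeff]
  simp only [coeff_C_mul, coeff_X_pow, mul_ite, mul_one, mul_zero]
  rw [Finset.sum_ite_eq]
  split_ifs with hk
  · rfl
  · have : {ω : ι → E | {i | ω i ∈ B i}.ncard = k} = ∅ := by
      refine Set.eq_empty_of_forall_notMem fun ω hω => hk (Finset.mem_range.2 ?_)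
      exact hω ▸ hlt ω
    rw [this, measureReal_empty]

open Polynomial in
lemma measureReal_ncard_lt (B : ι → Set E) (hB : ∀ i, MeasurableSet (B i)) (L : ℕ) :
    (Measure.pi μ).real {ω | {i | ω i ∈ B i}.ncard < L} = ∑ k ∈ Finset.range L,
      (∏ i, (C (1 - (μ i).real (B i)) + C ((μ i).real (B i)) * X) : ℝ[X]).coeff k := by
  have : {ω : ι → E | {i | ω i ∈ B i}.ncard < L} =
      ⋃ k ∈ Finset.range L, {ω | {i | ω i ∈ B i}.ncard = k} := by
    ext ω; simp
  rw [this, measureReal_biUnion_finset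
    (fun a _ b _ hab => Set.disjoint_left.2 fun ω h h' => hab (h.symm.trans h'))
    (fun k _ => (measureReal_ncard_eq μ B hB k).1)]
  exact Finset.sum_congr rfl fun k _ => (measureReal_ncard_eq μ B hB k).2

/-- Events of two kinds, with probabilities `a` and `b`. -/
lemma measureReal_ncard_lt_of_two [DecidableEq ι] (B : ι → Set E) (hB : ∀ i, MeasurableSet (B i)) (L : ℕ)
    (s t : Finset ι) (hst : Disjoint s t) (a b : ℝ) (ha : ∀ i ∈ s, (μ i).real (B i) = a)
    (hb : ∀ i ∈ t, (μ i).real (B i) = b) (h0 : ∀ i, i ∉ s → i ∉ t → B i = ∅) :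
    (Measure.pi μ).real {ω | {i | ω i ∈ B i}.ncard < L} =
      binomialSumTail L s.card t.card a b := by
  rw [measureReal_ncard_lt μ B hB]
  open Polynomial in
  have hprod : (∏ i, (C (1 - (μ i).real (B i)) + C ((μ i).real (B i)) * X) : ℝ[X]) =
      (C (1 - a) + C a * X) ^ s.card * (C (1 - b) + C b * X) ^ t.card := by
    rw [← Finset.prod_subset (Finset.subset_univ (s ∪ t)), Finset.prod_union hst,
      Finset.prod_congr rfl (fun i hi => by rw [ha i hi]),
      Finset.prod_congr (s₁ := t) rfl (fun i hi => by rw [hb i hi]), Finset.prod_const,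
      Finset.prod_const]
    intro i _ hi
    rw [Finset.mem_union, not_or] at hi
    simp [h0 i hi.1 hi.2]
  rw [hprod]
  unfold binomialSumTail
  refine Finset.sum_congr rfl fun k _ => ?_
  rw [Polynomial.coeff_mul]
  simp only [coeff_linear_pow]

end Product

/-! ### Acceptance probability in the finite market -/

section Market

variable {K : ℕ} (D D' : Measure ℝ) [IsProbabilityMeasure D] [IsProbabilityMeasure D']

/-- The law of one proposal. -/
def drawLaw (m : ℕ) (P : Measure ℝ) : Measure (Draw m) :=
  (uniformOn (Set.univ : Set (Fin m))).prod (markedLaw P)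

instance isProbabilityMeasure_drawLaw (m : ℕ) [NeZero m] (P : Measure ℝ)
    [IsProbabilityMeasure P] : IsProbabilityMeasure (drawLaw m P) := by
  unfold drawLaw; infer_instance

instance isProbabilityMeasure_ite (c : Prop) [Decidable c] :
    IsProbabilityMeasure (if c then D else D') := by split_ifs <;> infer_instance

lemma drawLaw_singleton_prod_above (m : ℕ) [NeZero m] (P : Measure ℝ) [IsProbabilityMeasure P]
    (u : Fin m) (e : ℝ × ℝ) :
    (drawLaw m P).real ({u} ×ˢ above e) = massAbove P e / m := by
  rw [drawLaw, measureReal_prod_prod, massAbove, measureReal_def, uniformOn_univ]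
  simp [div_eq_mul_inv, mul_comm]

lemma measurableSet_accepted {m : ℕ} {ι : Type} [Fintype ι] (L : ℕ) (p : ι) :
    MeasurableSet {ω : ι → Draw m | Accepted L ω p} := by
  classical
  have hB : ∀ q, MeasurableSet {ω : ι → Draw m | Outranks ω q p} := by
    intro q
    have h1 : MeasurableSet {ω : ι → Draw m | (ω q).1 = (ω p).1} :=
      measurableSet_eq_fun (by fun_prop) (by fun_prop)
    have h2 : MeasurableSet {ω : ι → Draw m | (ω q).2 ∈ above (ω p).2} :=
      measurableSet_above_prod.preimage
        (f := fun ω : ι → Draw m => ((ω p).2, (ω q).2)) (by fun_prop)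
    exact h1.inter h2
  have hncard : ∀ ω : ι → Draw m,
      {q | Outranks ω q p}.ncard = ∑ q, if Outranks ω q p then 1 else 0 := by
    intro ω
    rw [Set.ncard_eq_toFinset_card', Finset.sum_boole]
    simp
  have hm : Measurable fun ω : ι → Draw m => {q | Outranks ω q p}.ncard := by
    simp only [hncard]
    exact Finset.measurable_sum _ fun q _ => Measurable.ite (hB q) measurable_const
      measurable_const
  exact measurableSet_lt hm measurable_const

/-- The number of first proposals. -/
def firstCount (N : Fin K → ℕ) : ℕ := ∑ j : Fin K, if (j : ℕ) = 0 then N j else 0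

/-- The number of later proposals. -/
def laterCount (N : Fin K → ℕ) : ℕ := ∑ j : Fin K, if (j : ℕ) = 0 then 0 else N j

lemma card_filter_first (N : Fin K → ℕ) :
    (Finset.univ.filter fun q : Proposal N => (q.1 : ℕ) = 0).card = firstCount N := by
  rw [Finset.card_filter, Fintype.sum_sigma]
  refine Finset.sum_congr rfl fun j _ => ?_
  by_cases h : (j : ℕ) = 0 <;> simp [h]

lemma card_filter_later (N : Fin K → ℕ) :
    (Finset.univ.filter fun q : Proposal N => ¬ (q.1 : ℕ) = 0).card = laterCount N := by
  rw [Finset.card_filter, Fintype.sum_sigma]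
  refine Finset.sum_congr rfl fun j _ => ?_
  by_cases h : (j : ℕ) = 0 <;> simp [h]

/-- The probability that a given proposal is accepted. -/
lemma measureReal_accepted (m : ℕ) [NeZero m] (L : ℕ) (N : Fin K → ℕ) (p : Proposal N) :
    (proposalLaw D D' m N).real {ω | Accepted L ω p} =
      ∫ e, binomialSumTail L (firstCount N - if (p.1 : ℕ) = 0 then 1 else 0)
        (laterCount N - if (p.1 : ℕ) = 0 then 0 else 1)
        (massAbove D e / m) (massAbove D' e / m)
        ∂markedLaw (if (p.1 : ℕ) = 0 then D else D') := by
  set μ : Proposal N → Measure (Draw m) := fun q =>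
    drawLaw m (if (q.1 : ℕ) = 0 then D else D')
  have hlaw : proposalLaw D D' m N = Measure.pi μ := rfl
  set s := (Finset.univ.filter fun q : Proposal N => (q.1 : ℕ) = 0).erase p with hs
  set t := (Finset.univ.filter fun q : Proposal N => ¬ (q.1 : ℕ) = 0).erase p with ht
  have hsc : s.card = firstCount N - if (p.1 : ℕ) = 0 then 1 else 0 := by
    rw [hs, Finset.card_erase_eq_ite, card_filter_first]
    by_cases h : (p.1 : ℕ) = 0 <;> simp [h]
  have htc : t.card = laterCount N - if (p.1 : ℕ) = 0 then 0 else 1 := by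
    rw [ht, Finset.card_erase_eq_ite, card_filter_later]
    by_cases h : (p.1 : ℕ) = 0 <;> simp [h]
  -- With the draw `d` of `p` fixed, the other proposals outrank it independently. The coordinate
  -- `p` gets the empty event, since `p` does not outrank itself.
  have hfix : ∀ d : Draw m, (Measure.pi μ).real {ω | Accepted L (Function.update ω p d) p} =
      binomialSumTail L s.card t.card (massAbove D d.2 / m) (massAbove D' d.2 / m) := by
    intro d
    set B : Proposal N → Set (Draw m) := fun q => if q = p then ∅ else {d.1} ×ˢ above d.2 with hB
    have hset : {ω : Proposal N → Draw m | Accepted L (Function.update ω p d) p} =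
        {ω | {q | ω q ∈ B q}.ncard < L} := by
      ext ω
      have : {q | Outranks (Function.update ω p d) q p} = {q | ω q ∈ B q} := by
        ext q
        by_cases hq : q = p
        · subst hq; simp [Outranks, hB]
        · simp [Outranks, hB, hq, above]
      simp only [Accepted, Set.mem_ofPred_eq, this]
    have hBreal : ∀ q, q ≠ p → (μ q).real (B q) =
        massAbove (if (q.1 : ℕ) = 0 then D else D') d.2 / m := fun q hq => by
      rw [hB]
      simp only [hq, if_false]
      exact drawLaw_singleton_prod_above m _ _ _
    rw [hset]
    refine measureReal_ncard_lt_of_two μ B (fun q => ?_) L s t ?_ _ _ (fun q hq => ?_)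
      (fun q hq => ?_) fun q h1 h2 => ?_
    · by_cases hq : q = p
      · simp [hB, hq]
      · simp only [hB, hq, if_false]
        exact (measurableSet_singleton _).prod (measurableSet_above _)
    · exact (Finset.disjoint_filter_filter_not _ _ _).mono (Finset.erase_subset _ _)
        (Finset.erase_subset _ _)
    · have h := Finset.mem_erase.1 hq
      rw [hBreal q h.1, if_pos (Finset.mem_filter.1 h.2).2]
    · have h := Finset.mem_erase.1 hq
      rw [hBreal q h.1, if_neg (Finset.mem_filter.1 h.2).2]
    · have : q = p := by
        by_contra hq
        by_cases h : (q.1 : ℕ) = 0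
        · exact h1 (by simp [hs, hq, h])
        · exact h2 (by simp [ht, hq, h])
      simp [hB, this]
  have hmeas : Measurable fun x : Draw m × (Proposal N → Draw m) =>
      Function.update x.2 p x.1 :=
    measurable_update'.comp measurable_swap
  have hA := measurableSet_accepted (m := m) L p
  have hcont : AEStronglyMeasurable (fun e => binomialSumTail L s.card t.card
      (massAbove D e / m) (massAbove D' e / m))
      (markedLaw (if (p.1 : ℕ) = 0 then D else D')) := by
    have := measurable_massAbove D
    have := measurable_massAbove D'
    exact ((continuous_binomialSumTail L s.card t.card).measurable.comp
      (show Measurable fun e => (massAbove D e / m, massAbove D' e / m) by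
        fun_prop)).aestronglyMeasurable
  -- Resampling coordinate `p` and applying Fubini amounts to conditioning on the draw of `p`.
  rw [hlaw, ← hsc, ← htc, ← integral_indicator_one hA, ← map_update_prod_pi μ p,
    integral_map hmeas.aemeasurable
      (by exact (measurable_const.indicator hA).aestronglyMeasurable), integral_prod]
  · have hinner : ∀ d : Draw m, ∫ ω, {ω : Proposal N → Draw m | Accepted L ω p}.indicator 1
        (Function.update ω p d) ∂Measure.pi μ =
        binomialSumTail L s.card t.card (massAbove D d.2 / m) (massAbove D' d.2 / m) := by
      intro d
      have hAd : MeasurableSet {ω : Proposal N → Draw m | Accepted L (Function.update ω p d) p} :=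
        hA.preimage (hmeas.comp measurable_prodMk_left)
      rw [← hfix d, ← integral_indicator_one hAd]
      rfl
    simp only [hinner]
    have hsnd : (drawLaw m (if (p.1 : ℕ) = 0 then D else D')).map Prod.snd =
        markedLaw (if (p.1 : ℕ) = 0 then D else D') := by
      rw [drawLaw, Measure.map_snd_prod, measure_univ, one_smul]
    rw [← hsnd, integral_map measurable_snd.aemeasurable (hsnd ▸ hcont)]
  · exact Integrable.of_bound
      ((measurable_const.indicator hA).comp hmeas).aestronglyMeasurable 1
      (ae_of_all _ fun x => (norm_indicator_le_norm_self _ _).trans (by simp))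

end Market

/-! ### Convergence to the limit system -/

section Market

variable {K : ℕ} (D D' : Measure ℝ) [IsProbabilityMeasure D] [IsProbabilityMeasure D']

/-- Linearity of expectation: all proposals of one type have the same acceptance probability. -/
lemma acceptedFraction_eq {M : ℝ} {L n : ℕ} (hm : ⌈M * n⌉₊ ≠ 0) (x : Fin K → ℝ) (i : Fin K) :
    acceptedFraction D D' M L n x i = (⌊x i * n⌋₊ : ℝ) / n *
      ∫ e, binomialSumTail L ((firstCount fun j => ⌊x j * n⌋₊) - if (i : ℕ) = 0 then 1 else 0)
        ((laterCount fun j => ⌊x j * n⌋₊) - if (i : ℕ) = 0 then 0 else 1)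
        (massAbove D e / ⌈M * n⌉₊) (massAbove D' e / ⌈M * n⌉₊)
        ∂markedLaw (if (i : ℕ) = 0 then D else D') := by
  classical
  have : NeZero ⌈M * n⌉₊ := ⟨hm⟩
  set N : Fin K → ℕ := fun j => ⌊x j * n⌋₊
  have : IsProbabilityMeasure (proposalLaw D D' ⌈M * n⌉₊ N) := by
    change IsProbabilityMeasure (Measure.pi fun q : Proposal N =>
      drawLaw ⌈M * n⌉₊ (if (q.1 : ℕ) = 0 then D else D'))
    infer_instance
  have hcount : ∀ ω : Proposal N → Draw ⌈M * n⌉₊,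
      ({a : Fin ⌊x i * n⌋₊ | Accepted L ω ⟨i, a⟩}.ncard : ℝ) =
        ∑ a : Fin (N i), {ω : Proposal N → Draw ⌈M * n⌉₊ | Accepted L ω ⟨i, a⟩}.indicator 1 ω := by
    intro ω
    rw [Set.ncard_eq_toFinset_card']
    simp only [Set.indicator_apply, Set.mem_ofPred_eq, Pi.one_apply, Finset.sum_boole,
      Set.toFinset_ofPred]
    congr
  rw [acceptedFraction]
  simp only [hcount]
  rw [integral_finsetSum _ fun a _ => by
    exact (integrable_const (1 : ℝ)).indicator (measurableSet_accepted L _)]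
  set I := ∫ e, binomialSumTail L (firstCount N - if (i : ℕ) = 0 then 1 else 0)
    (laterCount N - if (i : ℕ) = 0 then 0 else 1) (massAbove D e / ⌈M * n⌉₊)
    (massAbove D' e / ⌈M * n⌉₊) ∂markedLaw (if (i : ℕ) = 0 then D else D')
  have hterm : ∀ a : Fin (N i), ∫ ω, {ω : Proposal N → Draw ⌈M * n⌉₊ |
      Accepted L ω ⟨i, a⟩}.indicator 1 ω ∂proposalLaw D D' ⌈M * n⌉₊ N = I := fun a =>
    (integral_indicator_one (measurableSet_accepted L _)).trans
      (measureReal_accepted D D' ⌈M * n⌉₊ L N ⟨i, a⟩)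
  rw [Finset.sum_congr rfl fun a _ => hterm a, Finset.sum_const, Finset.card_univ,
    Fintype.card_fin, nsmul_eq_mul]
  ring

lemma tendsto_floor_mul_div {φ : ℕ → ℕ} (hφ : Tendsto φ atTop atTop) {x : ℕ → ℝ} {a : ℝ}
    (hx0 : ∀ k, 0 ≤ x k) (hx : Tendsto x atTop (𝓝 a)) :
    Tendsto (fun k => (⌊x k * φ k⌋₊ : ℝ) / φ k) atTop (𝓝 a) := by
  have hinv : Tendsto (fun k => ((φ k : ℕ) : ℝ)⁻¹) atTop (𝓝 0) :=
    tendsto_inv_atTop_zero.comp (tendsto_natCast_atTop_atTop.comp hφ)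
  have hlo : Tendsto (fun k => x k - ((φ k : ℕ) : ℝ)⁻¹) atTop (𝓝 a) := by
    simpa using hx.sub hinv
  refine tendsto_of_tendsto_of_tendsto_of_le_of_le' hlo hx ?_ ?_
  · filter_upwards [hφ.eventually_gt_atTop 0] with k hk
    have hk' : (0 : ℝ) < φ k := Nat.cast_pos.2 hk
    rw [le_div_iff₀ hk', sub_mul, inv_mul_cancel₀ hk'.ne']
    linarith [Nat.lt_floor_add_one (x k * φ k)]
  · filter_upwards [hφ.eventually_gt_atTop 0] with k hk
    have hk' : (0 : ℝ) < φ k := Nat.cast_pos.2 hk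
    rw [div_le_iff₀ hk']
    exact Nat.floor_le (mul_nonneg (hx0 k) hk'.le)

/-- The case `m = 0`, where the quotient is 0 by convention, is included because the domination
below is required at every index, even those with no universities. -/
lemma massAbove_div_natCast_le_one (P : Measure ℝ) [IsProbabilityMeasure P] (e : ℝ × ℝ) (m : ℕ) :
    massAbove P e / m ≤ 1 :=
  (div_le_one_of_le₀ (a := massAbove P e) (b := max 1 m)
    ((massAbove_le_one P e).trans (le_max_left _ _)) (by positivity)).trans' (by
      rcases Nat.eq_zero_or_pos m with rfl | h
      · have := massAbove_nonneg P e
        simp only [Nat.cast_zero, div_zero]; positivity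
      · have : (1 : ℝ) ≤ m := by exact_mod_cast h
        rw [max_eq_right this])

/-- `acceptedFraction` converges to `limitFraction`, uniformly on the cube. -/
lemma tendsto_acceptedFraction {M : ℝ} (hM : 0 < M) (L : ℕ) {φ : ℕ → ℕ}
    (hφ : Tendsto φ atTop atTop) {z : ℕ → Fin K → ℝ} {x : Fin K → ℝ} (hz0 : ∀ k i, 0 ≤ z k i)
    (hz : Tendsto z atTop (𝓝 x)) (i : Fin K) :
    Tendsto (fun k => acceptedFraction D D' M L (φ k) (z k) i) atTop
      (𝓝 (limitFraction D D' M L x i)) := by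
  have hzj : ∀ j, Tendsto (fun k => z k j) atTop (𝓝 (x j)) := tendsto_pi_nhds.1 hz
  have hφR : Tendsto (fun k => ((φ k : ℕ) : ℝ)) atTop atTop :=
    tendsto_natCast_atTop_atTop.comp hφ
  have hfloor : ∀ j, Tendsto (fun k => (⌊z k j * φ k⌋₊ : ℝ) / φ k) atTop (𝓝 (x j)) := fun j =>
    tendsto_floor_mul_div hφ (fun k => hz0 k j) (hzj j)
  have hceil : Tendsto (fun k => (⌈M * φ k⌉₊ : ℝ) / φ k) atTop (𝓝 M) :=
    (tendsto_nat_ceil_mul_div_atTop hM.le).comp hφR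
  have hpos : ∀ᶠ k in atTop, 0 < φ k := hφ.eventually_gt_atTop 0
  have hcpos : ∀ᶠ k in atTop, ⌈M * φ k⌉₊ ≠ 0 := by
    filter_upwards [hpos] with k hk
    have : (0 : ℝ) < M * φ k := mul_pos hM (Nat.cast_pos.2 hk)
    exact (Nat.ceil_pos.2 this).ne'
  have hfirst : Tendsto (fun k => ((firstCount fun j => ⌊z k j * φ k⌋₊ : ℕ) : ℝ) / φ k) atTop
      (𝓝 (firstSum x)) := by
    have : ∀ k, ((firstCount fun j => ⌊z k j * φ k⌋₊ : ℕ) : ℝ) / φ k =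
        ∑ j : Fin K, if (j : ℕ) = 0 then (⌊z k j * φ k⌋₊ : ℝ) / φ k else 0 := fun k => by
      rw [firstCount, Nat.cast_sum, Finset.sum_div]
      exact Finset.sum_congr rfl fun j _ => by split_ifs <;> simp
    simp only [this]
    refine tendsto_finsetSum _ fun j _ => ?_
    split_ifs
    exacts [hfloor j, tendsto_const_nhds]
  have hlater : Tendsto (fun k => ((laterCount fun j => ⌊z k j * φ k⌋₊ : ℕ) : ℝ) / φ k) atTop
      (𝓝 (laterSum x)) := by
    have : ∀ k, ((laterCount fun j => ⌊z k j * φ k⌋₊ : ℕ) : ℝ) / φ k =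
        ∑ j : Fin K, if (j : ℕ) = 0 then 0 else (⌊z k j * φ k⌋₊ : ℝ) / φ k := fun k => by
      rw [laterCount, Nat.cast_sum, Finset.sum_div]
      exact Finset.sum_congr rfl fun j _ => by split_ifs <;> simp
    simp only [this]
    refine tendsto_finsetSum _ fun j _ => ?_
    split_ifs
    exacts [tendsto_const_nhds, hfloor j]
  have hmInf : Tendsto (fun k => (⌈M * φ k⌉₊ : ℝ)) atTop atTop :=
    tendsto_atTop_mono (fun k => Nat.le_ceil _) (hφR.const_mul_atTop hM)
  have hp : ∀ a : ℝ, Tendsto (fun k => a / (⌈M * φ k⌉₊ : ℝ)) atTop (𝓝 0) := fun a =>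
    hmInf.const_div_atTop a
  have hmean : ∀ (c : ℕ → ℕ) (r a : ℝ), Tendsto (fun k => (c k : ℝ) / φ k) atTop (𝓝 r) →
      Tendsto (fun k => (c k : ℝ) * (a / (⌈M * φ k⌉₊ : ℝ))) atTop (𝓝 (r * a / M)) := by
    intro c r a hc
    refine ((hc.mul_const a).div hceil hM.ne').congr' ?_
    filter_upwards [hpos, hcpos] with k hk hk'
    have : (φ k : ℝ) ≠ 0 := Nat.cast_ne_zero.2 hk.ne'
    have : (⌈M * φ k⌉₊ : ℝ) ≠ 0 := Nat.cast_ne_zero.2 hk'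
    simp only [Pi.div_apply]
    field_simp
  have hint : Tendsto (fun k => ∫ e, binomialSumTail L
        ((firstCount fun j => ⌊z k j * φ k⌋₊) - if (i : ℕ) = 0 then 1 else 0)
        ((laterCount fun j => ⌊z k j * φ k⌋₊) - if (i : ℕ) = 0 then 0 else 1)
        (massAbove D e / ⌈M * φ k⌉₊) (massAbove D' e / ⌈M * φ k⌉₊)
        ∂markedLaw (if (i : ℕ) = 0 then D else D')) atTop
      (𝓝 (limitRate D D' M L (if (i : ℕ) = 0 then D else D') (firstSum x) (laterSum x))) := by
    -- The binomial tail has a number of terms depending only on `L`, each at most 1; this gives a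
    -- constant dominating function.
    refine tendsto_integral_of_dominated_convergence
      (fun _ => ∑ k ∈ Finset.range L, ∑ _x ∈ Finset.HasAntidiagonal.antidiagonal k, (1 : ℝ))
      (fun k => ?_) (integrable_const _) (fun k => ae_of_all _ fun e => ?_)
      (ae_of_all _ fun e => ?_)
    · have := measurable_massAbove D
      have := measurable_massAbove D'
      exact ((continuous_binomialSumTail L _ _).measurable.comp
        (show Measurable fun e =>
          (massAbove D e / (⌈M * φ k⌉₊ : ℝ), massAbove D' e / (⌈M * φ k⌉₊ : ℝ)) by
          fun_prop)).aestronglyMeasurable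
    · have h := massAbove_nonneg D e
      have h' := massAbove_nonneg D' e
      exact abs_binomialSumTail_le L _ _ (by positivity) (massAbove_div_natCast_le_one D e _)
        (by positivity) (massAbove_div_natCast_le_one D' e _)
    · have h := massAbove_nonneg D e
      have h' := massAbove_nonneg D' e
      rw [add_div]
      have h1 : ∀ k, 0 ≤ massAbove D e / (⌈M * φ k⌉₊ : ℝ) := fun k => by positivity
      have h2 : ∀ k, 0 ≤ massAbove D' e / (⌈M * φ k⌉₊ : ℝ) := fun k => by positivity
      exact tendsto_binomialSumTail h1 (hp _) (tendsto_natSub_mul h1 (hp _) (hmean _ _ _ hfirst) _)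
        h2 (hp _) (tendsto_natSub_mul h2 (hp _) (hmean _ _ _ hlater) _) L
  refine ((hfloor i).mul hint).congr' ?_
  filter_upwards [hcpos] with k hk
  rw [acceptedFraction_eq D D' hk]

/-- A limit point of solutions of the system solves the limiting system. -/
lemma SolvesSystem.solvesLimitSystem {D D' : Measure ℝ} [IsProbabilityMeasure D]
    [IsProbabilityMeasure D'] {M : ℝ} (hM : 0 < M) {L : ℕ} {z : ℕ → Fin K → ℝ}
    (hsol : SolvesSystem D D' M L z) (hz0 : ∀ n i, 0 ≤ z n i) {φ : ℕ → ℕ}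
    (hφ : Tendsto φ atTop atTop) {x : Fin K → ℝ} (hz : Tendsto (z ∘ φ) atTop (𝓝 x)) :
    SolvesLimitSystem D D' M L x := by
  intro i
  have h1 := ((isLittleO_one_iff ℝ).1 (hsol i)).comp hφ
  have hzj : ∀ j, Tendsto (fun k => z (φ k) j) atTop (𝓝 (x j)) := tendsto_pi_nhds.1 hz
  have h2 : Tendsto (fun k => (Fin.cons 1 (z (φ k)) : Fin (K + 1) → ℝ) i.castSucc) atTop
      (𝓝 ((Fin.cons 1 x : Fin (K + 1) → ℝ) i.castSucc)) := by
    refine Fin.cases ?_ (fun j => ?_) i.castSucc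
    · simp
    · simpa using hzj j
  have h3 : Tendsto (fun k => (Fin.cons 0 (acceptedFraction D D' M L (φ k) (z (φ k))) :
      Fin (K + 1) → ℝ) i.castSucc) atTop
      (𝓝 ((Fin.cons 0 (limitFraction D D' M L x) : Fin (K + 1) → ℝ) i.castSucc)) := by
    refine Fin.cases ?_ (fun j => ?_) i.castSucc
    · simp
    · simpa using tendsto_acceptedFraction D D' hM L hφ (fun k => hz0 (φ k)) hz j
  exact sub_eq_zero.1 (tendsto_nhds_unique ((hzj i).sub (h2.sub h3)) h1)

lemma solvesSystem_const_iff {D D' : Measure ℝ} [IsProbabilityMeasure D]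
    [IsProbabilityMeasure D'] {M : ℝ} (hM : 0 < M) {L : ℕ} {y : Fin K → ℝ} (hy0 : ∀ i, 0 ≤ y i) :
    SolvesSystem D D' M L (fun _ => y) ↔ SolvesLimitSystem D D' M L y := by
  refine ⟨fun h => h.solvesLimitSystem hM (fun _ => hy0) tendsto_id tendsto_const_nhds,
    fun h i => (isLittleO_one_iff ℝ).2 ?_⟩
  suffices hlim : Tendsto (fun n => y i - ((Fin.cons 1 y : Fin (K + 1) → ℝ) i.castSucc -
      (Fin.cons 0 (acceptedFraction D D' M L n y) : Fin (K + 1) → ℝ) i.castSucc)) atTop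
      (𝓝 (y i - ((Fin.cons 1 y : Fin (K + 1) → ℝ) i.castSucc -
        (Fin.cons 0 (limitFraction D D' M L y) : Fin (K + 1) → ℝ) i.castSucc))) by
    rwa [sub_eq_zero.2 (h i)] at hlim
  refine tendsto_const_nhds.sub (tendsto_const_nhds.sub ?_)
  refine Fin.cases ?_ (fun j => ?_) i.castSucc
  · simp
  · simpa using tendsto_acceptedFraction D D' hM L tendsto_id (fun _ => hy0) tendsto_const_nhds j

end Market

end ApplicationMarket
end

theorem mainTheorem4 (K L : ℕ) (M : ℝ) (hM : 0 < M) (D D' : Measure ℝ)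
    [IsProbabilityMeasure D] [IsProbabilityMeasure D'] :
    (∃! y : Fin K → ℝ, y ∈ Set.Icc (0 : Fin K → ℝ) 1 ∧
      ApplicationMarket.SolvesSystem D D' M L (fun _ => y)) ∧
    (∀ (y : Fin K → ℝ) (z : ℕ → Fin K → ℝ),
      y ∈ Set.Icc (0 : Fin K → ℝ) 1 → ApplicationMarket.SolvesSystem D D' M L (fun _ => y) →
      (∀ n, z n ∈ Set.Icc (0 : Fin K → ℝ) 1) → ApplicationMarket.SolvesSystem D D' M L z →
      Tendsto z atTop (nhds y)) := by
  have huniq := ApplicationMarket.existsUnique_solvesLimitSystem K L hM D D'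
  refine ⟨?_, fun y z hy hysol hz hzsol => ?_⟩
  · obtain ⟨y, ⟨hy, hsol⟩, hu⟩ := huniq
    refine ⟨y, ⟨hy, (ApplicationMarket.solvesSystem_const_iff hM hy.1).2 hsol⟩, fun w hw => ?_⟩
    exact hu w ⟨hw.1, (ApplicationMarket.solvesSystem_const_iff hM hw.1.1).1 hw.2⟩
  -- Every subsequence has, by compactness of the cube, a further one that converges; its limit
  -- solves the limit system and is therefore `y`.
  · refine tendsto_of_subseq_tendsto fun ns hns => ?_
    obtain ⟨x, hx, ms, hms, hlim⟩ := isCompact_Icc.tendsto_subseq fun k => hz (ns k)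
    have hxsol := hzsol.solvesLimitSystem hM (fun n => (hz n).1)
      (hns.comp hms.tendsto_atTop) hlim
    have hxy : x = y := huniq.unique ⟨hx, hxsol⟩
      ⟨hy, (ApplicationMarket.solvesSystem_const_iff hM hy.1).1 hysol⟩
    exact ⟨ms, hxy ▸ hlim⟩
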